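/- All graphs are finite and simple. A set $D\subseteq V(G)$ is a dominating set of $G$ if every vertex not in $D$ is adjacent to a vertex of $D$. Two disjoint sets $A,B\subseteq V(G)$ form a coalition in $G$ if neither is a dominating set of $G$ but $A\cup B$ is. A coalition partition of $G$ is a partition $\mathcal P$ of $V(G)$ in which every member either is a dominating set consisting of one vertex, or is not a dominating set but forms a coalition with another member of $\mathcal P$; its coalition graph $\mathrm{CG}(G,\mathcal P)$ has the members of $\mathcal P$ as vertices, two being adjacent if and only if they form a coalition in $G$. Let $\Gamma_1$ denote the partition of $V(G)$ into singletons; $G$ is a singleton-partition graph (SP-graph) if $\Gamma_1$ is a coalition partition of $G$. A singleton coalition graph chain with initial graph $G_1$ is a finite sequence $G_1\to G_2\to\cdots\to G_k$ ($k\ge 1$) or an infinite sequence $G_1\to G_2\to\cdots$ of graphs such that, whenever $G_{i+1}$ is a term of the sequence, $G_i$ is an SP-graph and $G_{i+1}\cong \mathrm{CG}(G_i,\Gamma_1)$ (so the last term of a finite chain need not be an SP-graph). The length of the chain is $0$ if all its terms are isomorphic; otherwise it is $k-1$ for a finite chain with $k$ terms and $\infty$ for an infinite chain. Let $L_{\mathrm{SCC}}(G)$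 be the maximum length of a singleton coalition graph chain with initial graph $G$. **Theorem.** Let $G$ be an SP-graph with minimum degree $\delta(G)=2$ that has no full vertex (no vertex adjacent to all other vertices). Then $L_{\mathrm{SCC}}(G)=\infty$ or $L_{\mathrm{SCC}}(G)\le 5$. -/

import Mathlib

universe u

namespace Coalition

/-- `D` is a dominating set of `G`: every vertex not in `D` is adjacent to a vertex of `D`. -/
def IsDominating {V : Type u} (G : SimpleGraph V) (D : Set V) : Prop :=
  ∀ v, v ∉ D → ∃ d ∈ D, G.Adj v d

/-- The disjoint sets `A`, `B` form a coalition in `G`: neither of them is dominating, but their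
union is. (Such sets are automatically distinct.) -/
def FormCoalition {V : Type u} (G : SimpleGraph V) (A B : Set V) : Prop :=
  Disjoint A B ∧ ¬ IsDominating G A ∧ ¬ IsDominating G B ∧ IsDominating G (A ∪ B)

theorem FormCoalition.symm {V : Type u} {G : SimpleGraph V} {A B : Set V}
    (h : FormCoalition G A B) : FormCoalition G B A :=
  ⟨h.1.symm, h.2.2.1, h.2.1, by rw [Set.union_comm]; exact h.2.2.2⟩

theorem not_formCoalition_self {V : Type u} {G : SimpleGraph V} (A : Set V) :
    ¬ FormCoalition G A A :=
  fun h => h.2.1 (by simpa using h.2.2.2)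

/-- `P` is a coalition partition of `G`: a partition of the vertex set, each member of which is
either a dominating set with exactly one vertex, or is not dominating but forms a coalition with
some other member. -/
def IsCoalitionPartition {V : Type u} (G : SimpleGraph V) (P : Set (Set V)) : Prop :=
  Setoid.IsPartition P ∧
    ∀ A ∈ P, (IsDominating G A ∧ A.ncard = 1) ∨
      (¬ IsDominating G A ∧ ∃ B ∈ P, B ≠ A ∧ FormCoalition G A B)

/-- The coalition graph `CG(G, P)`: its vertices are the members of `P`, and two of them are
adjacent if and only if they form a coalition in `G`. -/
def coalitionGraph {V : Type u} (G : SimpleGraph V) (P : Set (Set V)) : SimpleGraph P where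
  Adj A B := FormCoalition G (A : Set V) (B : Set V)
  symm := ⟨fun _ _ h => h.symm⟩
  loopless := ⟨fun A h => not_formCoalition_self (A : Set V) h⟩

/-- The partition `Γ₁` of the vertex set into singletons. -/
def singletonPartition (V : Type u) : Set (Set V) :=
  {A | ∃ v : V, A = {v}}

/-- `G` is a singleton-partition graph (SP-graph): `Γ₁` is a coalition partition of `G`. -/
def IsSPGraph {V : Type u} (G : SimpleGraph V) : Prop :=
  IsCoalitionPartition G (singletonPartition V)

/-- The graph `CG(G, Γ₁)`. -/
def singletonCoalitionGraph {V : Type u} (G : SimpleGraph V) :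
    SimpleGraph (singletonPartition V) :=
  coalitionGraph G (singletonPartition V)

/-- A graph together with its vertex type; the terms of a chain have different vertex types. -/
structure BundledGraph : Type (u + 1) where
  V : Type u
  graph : SimpleGraph V

/-- `S 0 → S 1 → S 2 → ⋯` is a singleton coalition graph chain with initial graph `G` and with
`ℓ` arrows (`ℓ = ⊤` for an infinite chain): the terms are the `S i` with `i ≤ ℓ` (all `S i` if
`ℓ = ⊤`; terms with larger index are irrelevant), every term from which an arrow starts is an
SP-graph, and the next term is (up to isomorphism) its singleton coalition graph. The last term
of a finite chain is allowed not to be an SP-graph, as in `C₄ → K₄ → K̄₄`. -/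
def IsSCChain {V : Type u} (G : SimpleGraph V) (ℓ : ℕ∞) (S : ℕ → BundledGraph.{u}) : Prop :=
  S 0 = ⟨V, G⟩ ∧
    ∀ i : ℕ, (i : ℕ∞) < ℓ →
      IsSPGraph (S i).graph ∧
        Nonempty (singletonCoalitionGraph (S i).graph ≃g (S (i + 1)).graph)

open Classical in
/-- The length of a chain with `ℓ` arrows: it is `ℓ` (one less than the number of terms), except
that by convention it is `0` if all the terms of the chain are isomorphic. -/
noncomputable def chainLength (ℓ : ℕ∞) (S : ℕ → BundledGraph.{u}) : ℕ∞ :=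
  if ∀ i j : ℕ, (i : ℕ∞) ≤ ℓ → (j : ℕ∞) ≤ ℓ → Nonempty ((S i).graph ≃g (S j).graph) then 0 else ℓ

/-- `L_SCC(G)`: the maximum length of a singleton coalition graph chain with initial graph `G`. -/
noncomputable def LSCC {V : Type u} (G : SimpleGraph V) : ℕ∞ :=
  sSup {L | ∃ (ℓ : ℕ∞) (S : ℕ → BundledGraph.{u}), IsSCChain G ℓ S ∧ L = chainLength ℓ S}

end Coalition

/-! ### The singleton coalition graph as an operator on a fixed vertex set -/

namespace Coalition

/-! A chain is, up to isomorphism, the orbit of `G` under `step`, so it suffices that enough SP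
iterates force the orbit to become periodic: then every iterate is SP, and the length is infinite,
or `0` by convention.

Let `x` have exactly the neighbours `y`, `z`. An edge of `step G` is a pair dominating `x`, so it
meets `{x, y, z}`: the other vertices are independent in `step G` (`isCore_step_of_neighbors`). With
at least three others this persists, since two of them never dominate a third. Being SP for a few
more steps excludes full vertices and forces `x`, `y`, `z` to be joined to all the others and not to
each other. So `step G` is the complete bipartite graph `K_{3,n-3}`, a fixed point of `step`
(`IsCore.step_eq_self`). Only four or five vertices remain, where a finite check gives `step^[3] G =
step^[1] G`. -/

/-- `v` is adjacent to every other vertex of `G`. -/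
def IsFull {V : Type*} (G : SimpleGraph V) (v : V) : Prop :=
  ∀ w, w ≠ v → G.Adj w v

/-- `{u, v}` is a dominating set of `G`. -/
def PairDominates {V : Type*} (G : SimpleGraph V) (u v : V) : Prop :=
  ∀ w, w ≠ u → w ≠ v → G.Adj w u ∨ G.Adj w v

theorem PairDominates.symm {V : Type*} {G : SimpleGraph V} {u v : V} (h : PairDominates G u v) :
    PairDominates G v u :=
  fun w hv hu => (h w hu hv).symm

/-- The singleton coalition graph of `G`, carried by the vertex type of `G`. -/
def step {V : Type*} (G : SimpleGraph V) : SimpleGraph V where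
  Adj u v := u ≠ v ∧ ¬ IsFull G u ∧ ¬ IsFull G v ∧ PairDominates G u v
  symm := ⟨fun _ _ h => ⟨h.1.symm, h.2.2.1, h.2.1, h.2.2.2.symm⟩⟩
  loopless := ⟨fun _ h => h.1 rfl⟩

theorem step_adj {V : Type*} {G : SimpleGraph V} {u v : V} :
    (step G).Adj u v ↔ u ≠ v ∧ ¬ IsFull G u ∧ ¬ IsFull G v ∧ PairDominates G u v :=
  Iff.rfl

/-- Every vertex of `G` is full or has a neighbour in `step G`. -/
def IsSP {V : Type*} (G : SimpleGraph V) : Prop :=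
  ∀ v, IsFull G v ∨ ∃ u, (step G).Adj v u

theorem isDominating_singleton {V : Type*} {G : SimpleGraph V} {v : V} :
    IsDominating G {v} ↔ IsFull G v := by
  simp [IsDominating, IsFull]

theorem isDominating_pair {V : Type*} {G : SimpleGraph V} {u v : V} :
    IsDominating G ({u} ∪ {v}) ↔ PairDominates G u v := by
  simp only [IsDominating, PairDominates, Set.mem_union, Set.mem_singleton_iff, not_or, and_imp,
    or_and_right, exists_or, exists_eq_left]

theorem formCoalition_singleton {V : Type*} {G : SimpleGraph V} {u v : V} :
    FormCoalition G {u} {v} ↔ (step G).Adj u v := by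
  rw [FormCoalition, isDominating_singleton, isDominating_singleton, isDominating_pair, step_adj,
    Set.disjoint_singleton]

theorem isPartition_singletonPartition (V : Type*) :
    Setoid.IsPartition (singletonPartition V) := by
  refine ⟨?_, fun a => ⟨{a}, ⟨⟨a, rfl⟩, rfl⟩, ?_⟩⟩
  · rintro ⟨v, hv⟩
    exact Set.singleton_ne_empty v hv.symm
  · rintro _ ⟨⟨v, rfl⟩, h⟩
    rw [Set.mem_singleton_iff.1 h]

theorem isSPGraph_iff {V : Type*} {G : SimpleGraph V} : IsSPGraph G ↔ IsSP G := by
  constructor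
  · rintro ⟨-, h⟩ v
    rcases h {v} ⟨v, rfl⟩ with h | ⟨-, _, ⟨u, rfl⟩, -, h⟩
    · exact Or.inl (isDominating_singleton.1 h.1)
    · exact Or.inr ⟨u, formCoalition_singleton.1 h⟩
  · intro h
    refine ⟨isPartition_singletonPartition V, ?_⟩
    rintro _ ⟨v, rfl⟩
    rcases h v with h | ⟨u, h⟩
    · exact Or.inl ⟨isDominating_singleton.2 h, Set.ncard_singleton v⟩
    · refine Or.inr ⟨fun hv => h.2.1 (isDominating_singleton.1 hv), {u}, ⟨u, rfl⟩, ?_,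
        formCoalition_singleton.2 h⟩
      exact fun e => h.1 (Set.singleton_injective e).symm

/-- The vertices of `G` as the members of the singleton partition. -/
noncomputable def singletonEquiv (V : Type*) : V ≃ singletonPartition V :=
  Equiv.ofBijective (fun v => ⟨{v}, v, rfl⟩)
    ⟨fun _ _ h => Set.singleton_injective (congrArg Subtype.val h),
      by rintro ⟨_, v, rfl⟩; exact ⟨v, rfl⟩⟩

/-- `step G` is isomorphic to the singleton coalition graph of `G`. -/
noncomputable def stepIso {V : Type*} (G : SimpleGraph V) : step G ≃g singletonCoalitionGraph G where
  toEquiv := singletonEquiv V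
  map_rel_iff' := formCoalition_singleton

theorem isFull_comap {V W : Type*} (e : V ≃ W) (G : SimpleGraph W) (v : V) :
    IsFull (G.comap e) v ↔ IsFull G (e v) := by
  constructor
  · intro h w hw
    simpa using h (e.symm w) (fun he => hw (by simp [← he]))
  · exact fun h w hw => h (e w) (e.injective.ne hw)

theorem step_comap {V W : Type*} (e : V ≃ W) (G : SimpleGraph W) :
    step (G.comap e) = (step G).comap e := by
  ext u v
  rw [SimpleGraph.comap_adj, step_adj, step_adj, isFull_comap, isFull_comap]
  refine and_congr e.injective.ne_iff.symm (and_congr_right' (and_congr_right' ⟨?_, ?_⟩))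
  · intro h w hu hv
    simpa using h (e.symm w) (fun he => hu (by simp [← he])) (fun he => hv (by simp [← he]))
  · exact fun h w hu hv => h (e w) (e.injective.ne hu) (e.injective.ne hv)

theorem iterate_step_comap {V W : Type*} (e : V ≃ W) (G : SimpleGraph W) (i : ℕ) :
    step^[i] (G.comap e) = (step^[i] G).comap e := by
  induction i with
  | zero => rfl
  | succ i ih => rw [Function.iterate_succ_apply', Function.iterate_succ_apply', ih, step_comap]

theorem isSP_comap {V W : Type*} (e : V ≃ W) (G : SimpleGraph W) :
    IsSP (G.comap e) ↔ IsSP G := by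
  simp only [IsSP, isFull_comap, step_comap, SimpleGraph.comap_adj]
  exact e.forall_congr fun {v} => or_congr Iff.rfl (e.exists_congr fun _ => Iff.rfl)

theorem comap_iso {V W : Type*} {G : SimpleGraph V} {H : SimpleGraph W} (φ : G ≃g H) :
    H.comap φ.toEquiv = G := by
  ext u v
  exact φ.map_rel_iff

theorem IsSP.of_iso {V W : Type*} {G : SimpleGraph V} {H : SimpleGraph W} (φ : G ≃g H)
    (h : IsSP H) : IsSP G := by
  rw [← comap_iso φ]
  exact (isSP_comap _ _).2 h

/-- Isomorphic graphs have isomorphic singleton coalition graphs. -/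
def stepCongr {V W : Type*} {G : SimpleGraph V} {H : SimpleGraph W} (φ : G ≃g H) :
    step G ≃g step H where
  toEquiv := φ.toEquiv
  map_rel_iff' {u v} := by
    conv_rhs => rw [← comap_iso φ, step_comap]
    rfl

/-! ### Graphs with an independent set whose complement has three vertices -/

/-- `a`, `b`, `c` are distinct and every edge of `G` meets `{a, b, c}`. -/
structure IsCore {V : Type*} (G : SimpleGraph V) (a b c : V) : Prop where
  ab : a ≠ b
  ac : a ≠ c
  bc : b ≠ c
  cover : ∀ u v, G.Adj u v → u = a ∨ u = b ∨ u = c ∨ v = a ∨ v = b ∨ v = c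

theorem IsCore.rotate {V : Type*} {G : SimpleGraph V} {a b c : V} (h : IsCore G a b c) :
    IsCore G b c a :=
  ⟨h.bc, h.ab.symm, h.ac.symm, fun u v e => by have := h.cover u v e; tauto⟩

theorem IsCore.swap {V : Type*} {G : SimpleGraph V} {a b c : V} (h : IsCore G a b c) :
    IsCore G a c b :=
  ⟨h.ac, h.ab, h.bc.symm, fun u v e => by have := h.cover u v e; tauto⟩

/-- `v` is not one of `a`, `b`, `c`. -/
def Outside {V : Type*} (a b c v : V) : Prop := v ≠ a ∧ v ≠ b ∧ v ≠ c

/-- `s` is adjacent to all vertices other than `a`, `b`, `c`. -/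
def Complete {V : Type*} (G : SimpleGraph V) (a b c s : V) : Prop :=
  ∀ r, Outside a b c r → G.Adj r s

theorem Outside.rotate {V : Type*} {a b c v : V} (h : Outside a b c v) : Outside b c a v :=
  ⟨h.2.1, h.2.2, h.1⟩

theorem Outside.swap {V : Type*} {a b c v : V} (h : Outside a b c v) : Outside a c b v :=
  ⟨h.1, h.2.2, h.2.1⟩

theorem Complete.rotate {V : Type*} {G : SimpleGraph V} {a b c s : V} (h : Complete G a b c s) :
    Complete G b c a s :=
  fun r hr => h r hr.rotate.rotate

theorem Complete.swap {V : Type*} {G : SimpleGraph V} {a b c s : V} (h : Complete G a b c s) :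
    Complete G a c b s :=
  fun r hr => h r hr.swap

/-- There are at least three vertices other than `a`, `b`, `c`. -/
def Roomy {V : Type*} (a b c : V) : Prop :=
  ∀ u v, ∃ r, Outside a b c r ∧ r ≠ u ∧ r ≠ v

theorem Roomy.rotate {V : Type*} {a b c : V} (h : Roomy a b c) : Roomy b c a := fun u v =>
  let ⟨r, hr, h'⟩ := h u v
  ⟨r, hr.rotate, h'⟩

theorem Roomy.swap {V : Type*} {a b c : V} (h : Roomy a b c) : Roomy a c b := fun u v =>
  let ⟨r, hr, h'⟩ := h u v
  ⟨r, hr.swap, h'⟩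

section
variable {V : Type*} {G : SimpleGraph V} {a b c : V}

theorem isCore_step_of_neighbors (hab : a ≠ b) (hac : a ≠ c) (hbc : b ≠ c)
    (hN : ∀ w, G.Adj a w → w = b ∨ w = c) : IsCore (step G) a b c := by
  refine ⟨hab, hac, hbc, fun u v h => ?_⟩
  by_contra! hc
  rcases h.2.2.2 a hc.1.symm hc.2.2.2.1.symm with h | h
  · exact (hN u h).elim hc.2.1 hc.2.2.1
  · exact (hN v h).elim hc.2.2.2.2.1 hc.2.2.2.2.2

theorem IsCore.not_adj (hG : IsCore G a b c) {r s : V} (hr : Outside a b c r)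
    (hs : Outside a b c s) : ¬ G.Adj r s := by
  intro h
  obtain ⟨h1, h2, h3⟩ := hr
  obtain ⟨h4, h5, h6⟩ := hs
  have := hG.cover r s h
  tauto

/-- Two outside vertices cannot dominate a third one, as the outside is independent. -/
theorem IsCore.step (hG : IsCore G a b c) (hR : Roomy a b c) : IsCore (step G) a b c := by
  refine ⟨hG.ab, hG.ac, hG.bc, fun u v h => ?_⟩
  by_contra! hc
  have hu : Outside a b c u := ⟨hc.1, hc.2.1, hc.2.2.1⟩
  have hv : Outside a b c v := hc.2.2.2
  obtain ⟨r, hr, h1, h2⟩ := hR u v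
  exact (h.2.2.2 r h1 h2).elim (hG.not_adj hr hu) (hG.not_adj hr hv)

theorem IsCore.not_isFull (hG : IsCore G a b c) (hR : Roomy a b c) {r : V}
    (hr : Outside a b c r) : ¬ IsFull G r := fun h =>
  let ⟨s, hs, hsr, _⟩ := hR r r
  hG.not_adj hs hr (h s hsr)

/-- A full vertex `w` of `G` is isolated in `step G`. Hence an outside `r ≠ w` is not full there,
and a partner of `r` would have to be `w`, which leaves another outside vertex undominated. -/
theorem IsCore.not_isFull_of_isSP_step (hG : IsCore G a b c) (hR : Roomy a b c)
    (hS : IsSP (Coalition.step G)) (w : V) : ¬ IsFull G w := by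
  intro hw
  obtain ⟨r, hr, hrw, -⟩ := hR w w
  obtain ⟨s, hs, hsw, hsr⟩ := hR w r
  have key : ¬ (Coalition.step G).Adj w r ∧ ∀ u, ¬ (Coalition.step G).Adj w u :=
    ⟨fun h => h.2.1 hw, fun u h => h.2.1 hw⟩
  rcases hS r with h | ⟨u, h⟩
  · exact key.1 (h w hrw.symm)
  · by_cases huw : u = w
    · subst huw
      exact (h.2.2.2 s hsr hsw).elim ((hG.step hR).not_adj hs hr) (fun h' => key.2 s h'.symm)
    · exact (h.2.2.2 w hrw.symm (Ne.symm huw)).elim (key.2 r) (key.2 u)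

theorem Complete.of_step (hG : IsCore G a b c) (hR : Roomy a b c) {s : V}
    (h : Complete (step G) a b c s) : Complete G a b c s := by
  intro r hr
  by_cases hrs : r = s
  -- `s` itself cannot be outside: it would be its own neighbour.
  · exact absurd (h r hr) (by rw [hrs]; exact SimpleGraph.irrefl _)
  · obtain ⟨t, ht, htr, -⟩ := hR r r
    exact ((h t ht).2.2.2 r htr.symm hrs).resolve_left (hG.not_adj hr ht)

theorem IsCore.exists_complete (hG : IsCore G a b c) (hR : Roomy a b c)
    (hS : IsSP (Coalition.step G)) :
    Complete G a b c a ∨ Complete G a b c b ∨ Complete G a b c c := by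
  have hG' := hG.step hR
  obtain ⟨r, hr, -⟩ := hR a a
  obtain ⟨s, h⟩ := (hS r).resolve_left (hG'.not_isFull hR hr)
  have hs : s = a ∨ s = b ∨ s = c := by
    by_contra! hs
    exact (hG'.step hR).not_adj hr hs h
  -- The partner `s` of `r` in `step G` works. If `s` missed an outside `t` in `G`, no pair `{q, s}`
  -- with `q ≠ t` outside would dominate `t`; so in `step G` neither `r` nor `s` would reach a third
  -- outside vertex.
  suffices H : Complete G a b c s by
    rcases hs with rfl | rfl | rfl <;> tauto
  intro t ht
  by_contra hts
  have hne : ∀ q, Outside a b c q → q ≠ s := by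
    rintro q ⟨h1, h2, h3⟩ rfl
    tauto
  have hadj : ∀ q, Outside a b c q → q ≠ t → ¬ (Coalition.step G).Adj q s := fun q hq hqt hqs =>
    (hqs.2.2.2 t (Ne.symm hqt) (hne t ht)).elim (hG.not_adj ht hq) hts
  obtain ⟨q, hq, hqr, hqt⟩ := hR r t
  exact (h.2.2.2 q hqr (hne q hq)).elim (hG'.not_adj hq hr) (hadj q hq hqt)

/-- If `a` is complete to the outside in both `G` and `step G`, then so is in `G` every vertex of
the triple that is not adjacent to `a`. -/
theorem IsCore.complete_of_not_adj (hG : IsCore G a b c) (ha : Complete (Coalition.step G) a b c a)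
    (h : ¬ G.Adj a b) : Complete G a b c b := fun r hr =>
  (((ha r hr).2.2.2 b hr.2.1.symm hG.ab.symm).resolve_right (fun h' => h h'.symm)).symm

theorem exists_not_adj_of_complete (ha : Complete G a b c a) (hf : ¬ IsFull G a) :
    ¬ G.Adj a b ∨ ¬ G.Adj a c := by
  by_contra! h
  refine hf fun w hw => ?_
  by_cases hb : w = b
  · exact hb ▸ h.1.symm
  by_cases hc : w = c
  · exact hc ▸ h.2.symm
  exact ha w ⟨hw, hb, hc⟩

/-- A missing edge `ac`, in `G` or in `step G`, makes `c` complete. If both edges are present, `{a,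
b}` dominates `G`, so `a` is joined to `b` as well and is full in `step G`, which is excluded. -/
theorem IsCore.complete_third (hG : IsCore G a b c) (hR : Roomy a b c)
    (h1 : IsSP (Coalition.step G)) (h2 : IsSP (Coalition.step (Coalition.step G)))
    (ha : Complete (Coalition.step (Coalition.step G)) a b c a) : Complete G a b c c := by
  have hG' := hG.step hR
  have ha1 := ha.of_step hG' hR
  have ha0 := ha1.of_step hG hR
  have hf := hG.not_isFull_of_isSP_step hR h1
  have hf' := hG'.not_isFull_of_isSP_step hR h2
  by_cases hac : G.Adj a c
  swap
  · exact (hG.swap.complete_of_not_adj ha1.swap hac).swap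
  by_cases hac' : (Coalition.step G).Adj a c
  swap
  · exact (hG'.swap.complete_of_not_adj ha.swap hac').swap.of_step hG hR
  exfalso
  have hab' : (Coalition.step G).Adj a b := by
    refine ⟨hG.ab, hf a, hf b, fun w hwa hwb => Or.inl ?_⟩
    by_cases hwc : w = c
    · exact hwc ▸ hac.symm
    · exact ha0 w ⟨hwa, hwb, hwc⟩
  exact (exists_not_adj_of_complete ha1 (hf' a)).elim (· hab') (· hac')

theorem IsCore.complete_all (hG : IsCore G a b c) (hR : Roomy a b c)
    (h1 : IsSP (Coalition.step G)) (h2 : IsSP (Coalition.step (Coalition.step G)))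
    (ha : Complete (Coalition.step (Coalition.step G)) a b c a) :
    Complete G a b c a ∧ Complete G a b c b ∧ Complete G a b c c :=
  ⟨(ha.of_step (hG.step hR) hR).of_step hG hR,
    (hG.swap.complete_third hR.swap h1 h2 ha.swap).swap, hG.complete_third hR h1 h2 ha⟩

/-- An edge `ab` would let `c` form a dominating pair with every other vertex, making `c` full in
`step G`. -/
theorem IsCore.not_adj_of_complete (hG : IsCore G a b c) (hR : Roomy a b c)
    (h1 : IsSP (Coalition.step G)) (h2 : IsSP (Coalition.step (Coalition.step G)))
    (ha : Complete G a b c a) (hb : Complete G a b c b) (hc : Complete G a b c c) :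
    ¬ G.Adj a b := by
  intro hab
  have hf := hG.not_isFull_of_isSP_step hR h1
  refine (hG.step hR).not_isFull_of_isSP_step hR h2 c fun w hw => ⟨hw, hf w, hf c, ?_⟩
  intro v hvw hvc
  by_cases hva : v = a
  · subst hva
    by_cases hwb : w = b
    · exact Or.inl (hwb ▸ hab)
    · exact Or.inl (ha w ⟨hvw.symm, hwb, hw⟩).symm
  · by_cases hvb : v = b
    · subst hvb
      by_cases hwa : w = a
      · exact Or.inl (hwa ▸ hab.symm)
      · exact Or.inl (hb w ⟨hwa, hvw.symm, hw⟩).symm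
    · exact Or.inr (hc v ⟨hva, hvb, hvc⟩)

/-- The complete bipartite graph with parts `{a, b, c}` and the outside is fixed by `step`. -/
theorem IsCore.step_eq (hG : IsCore G a b c) (hR : Roomy a b c)
    (hf : ∀ w, ¬ IsFull G w)
    (ha : Complete G a b c a) (hb : Complete G a b c b) (hc : Complete G a b c c)
    (hab : ¬ G.Adj a b) (hbc : ¬ G.Adj b c) (hca : ¬ G.Adj c a) : Coalition.step G = G := by
  have hin : ∀ u v, (u = a ∨ u = b ∨ u = c) → (v = a ∨ v = b ∨ v = c) → ¬ G.Adj u v := by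
    have hba := fun h => hab (SimpleGraph.Adj.symm h)
    have hcb := fun h => hbc (SimpleGraph.Adj.symm h)
    have hac := fun h => hca (SimpleGraph.Adj.symm h)
    rintro u v (rfl | rfl | rfl) (rfl | rfl | rfl) <;>
      first | exact SimpleGraph.irrefl _ | assumption
  have hmix : ∀ u v, Outside a b c u → (v = a ∨ v = b ∨ v = c) → G.Adj u v := by
    rintro u v hu (rfl | rfl | rfl)
    exacts [ha u hu, hb u hu, hc u hu]
  have hdich : ∀ u, (u = a ∨ u = b ∨ u = c) ∨ Outside a b c u := by
    intro u
    unfold Outside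
    tauto
  have hdom : ∀ u v, Outside a b c u → (v = a ∨ v = b ∨ v = c) → PairDominates G u v := by
    intro u v hu hv w _ _
    rcases hdich w with hw | hw
    · exact Or.inl (hmix u w hu hw).symm
    · exact Or.inr (hmix w v hw hv)
  have hthird : ∀ u v, (u = a ∨ u = b ∨ u = c) → (v = a ∨ v = b ∨ v = c) →
      ∃ w, (w = a ∨ w = b ∨ w = c) ∧ w ≠ u ∧ w ≠ v := by
    have h1 := hG.ab
    have h2 := hG.ac
    have h3 := hG.bc
    intro u v hu hv
    by_cases hua : a ≠ u ∧ a ≠ v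
    · exact ⟨a, by simp, hua⟩
    by_cases hub : b ≠ u ∧ b ≠ v
    · exact ⟨b, by simp, hub⟩
    refine ⟨c, by simp, ?_⟩
    grind
  ext u v
  rcases hdich u with hu | hu <;> rcases hdich v with hv | hv
  · refine iff_of_false (fun h => ?_) (hin u v hu hv)
    obtain ⟨w, hw, hwu, hwv⟩ := hthird u v hu hv
    exact (h.2.2.2 w hwu hwv).elim (hin w u hw hu) (hin w v hw hv)
  · refine iff_of_true ?_ (hmix v u hv hu).symm
    exact ⟨(hmix v u hv hu).symm.ne, hf u, hf v, (hdom v u hv hu).symm⟩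
  · exact iff_of_true ⟨(hmix u v hu hv).ne, hf u, hf v, hdom u v hu hv⟩ (hmix u v hu hv)
  · exact iff_of_false ((hG.step hR).not_adj hu hv) (hG.not_adj hu hv)

theorem IsCore.step_eq_of_complete (hG : IsCore G a b c) (hR : Roomy a b c)
    (h1 : IsSP (Coalition.step G)) (h2 : IsSP (Coalition.step (Coalition.step G)))
    (ha : Complete (Coalition.step (Coalition.step G)) a b c a) : Coalition.step G = G := by
  obtain ⟨ha, hb, hc⟩ := hG.complete_all hR h1 h2 ha
  refine hG.step_eq hR (hG.not_isFull_of_isSP_step hR h1) ha hb hc ?_ ?_ ?_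
  · exact hG.not_adj_of_complete hR h1 h2 ha hb hc
  · exact hG.rotate.not_adj_of_complete hR.rotate h1 h2 hb.rotate hc.rotate ha.rotate
  · exact hG.rotate.rotate.not_adj_of_complete hR.rotate.rotate h1 h2 hc.rotate.rotate
      ha.rotate.rotate hb.rotate.rotate

theorem IsCore.step_eq_self (hG : IsCore G a b c) (hR : Roomy a b c)
    (h : ∀ i ≤ 3, IsSP (Coalition.step^[i] G)) : Coalition.step G = G := by
  have h1 : IsSP (Coalition.step G) := h 1 (by norm_num)
  have h2 : IsSP (Coalition.step (Coalition.step G)) := h 2 (by norm_num)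
  rcases ((hG.step hR).step hR).exists_complete hR (h 3 le_rfl) with ha | ha | ha
  · exact hG.step_eq_of_complete hR h1 h2 ha
  · exact hG.rotate.step_eq_of_complete hR.rotate h1 h2 ha.rotate
  · exact hG.rotate.rotate.step_eq_of_complete hR.rotate.rotate h1 h2 ha.rotate.rotate

end

end Coalition

namespace Coalition

/-! ### Graphs with at most five vertices -/

section
variable {n : ℕ}

/-- A Boolean matrix, stored as a natural number. -/
def tabulate (f : Fin n → Fin n → Bool) (i j : Fin n) : Bool :=
  (Nat.ofBits fun k : Fin (n * n) => f k.divNat k.modNat).testBit (finProdFinEquiv (i, j))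

theorem tabulate_eq (f : Fin n → Fin n → Bool) : tabulate f = f := by
  ext i j
  rw [tabulate, Nat.testBit_ofBits_lt _ _ (finProdFinEquiv (i, j)).2]
  have h := finProdFinEquiv.symm_apply_apply (i, j)
  rw [finProdFinEquiv_symm_apply, Prod.mk.injEq] at h
  rw [Fin.eta, h.1, h.2]

/-- Boolean version of `IsFull`. -/
def fullB (f : Fin n → Fin n → Bool) (v : Fin n) : Bool :=
  (List.finRange n).all fun w => w == v || f w v

/-- Boolean version of `step`. -/
def stepB (f : Fin n → Fin n → Bool) (u v : Fin n) : Bool :=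
  u != v && !fullB f u && !fullB f v &&
    (List.finRange n).all fun w => w == u || w == v || f w u || f w v

/-- Boolean version of `IsSP`. -/
def isSPB (f : Fin n → Fin n → Bool) : Bool :=
  (List.finRange n).all fun v => fullB f v || (List.finRange n).any fun u => stepB f v u

/-- `f` is the adjacency matrix of `G`. -/
def Represents (f : Fin n → Fin n → Bool) (G : SimpleGraph (Fin n)) : Prop :=
  ∀ i j, f i j = true ↔ G.Adj i j

variable {f : Fin n → Fin n → Bool} {G : SimpleGraph (Fin n)}

theorem Represents.fullB (h : Represents f G) (v : Fin n) : fullB f v = true ↔ IsFull G v := by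
  simp [Coalition.fullB, IsFull, h _ _, or_iff_not_imp_left]

theorem Represents.stepB (h : Represents f G) : Represents (stepB f) (step G) := by
  intro u v
  have hu := h.fullB u
  have hv := h.fullB v
  simp [Coalition.stepB, step_adj, PairDominates, h _ _, ← hu, ← hv, or_iff_not_imp_left, and_assoc]

theorem Represents.isSPB (h : Represents f G) : isSPB f = true ↔ IsSP G := by
  simp [Coalition.isSPB, IsSP, h.fullB _, h.stepB _ _]

theorem Represents.ext {G' : SimpleGraph (Fin n)} (h : Represents f G) (h' : Represents f G') :
    G = G' := by
  ext i j
  rw [← h i j, ← h' i j]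

theorem Represents.tabulate (h : Represents f G) : Represents (tabulate f) G := by
  rwa [tabulate_eq]

/-- If the first four iterates of `stepB` are singleton-partition graphs, then the third iterate
equals the first one. -/
def recursB (f : Fin n → Fin n → Bool) : Bool :=
  if isSPB f then
    let f₁ := tabulate (stepB f)
    if isSPB f₁ then
      let f₂ := tabulate (stepB f₁)
      if isSPB f₂ then
        let f₃ := tabulate (stepB f₂)
        if isSPB f₃ then
          (List.finRange n).all fun i => (List.finRange n).all fun j => f₃ i j == f₁ i j
        else true
      else true
    else true
  else true

theorem Represents.iterate_eq (h : Represents f G) (hf : recursB f = true)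
    (hG : ∀ i ≤ 3, IsSP (step^[i] G)) : step^[3] G = step^[1] G := by
  have r1 := h.stepB.tabulate
  have r2 := r1.stepB.tabulate
  have r3 := r2.stepB.tabulate
  have s0 := h.isSPB.2 (hG 0 (by norm_num))
  have s1 := r1.isSPB.2 (hG 1 (by norm_num))
  have s2 := r2.isSPB.2 (hG 2 (by norm_num))
  have s3 := r3.isSPB.2 (hG 3 (by norm_num))
  simp only [recursB, s0, s1, s2, s3, if_true, List.all_eq_true, List.mem_finRange, forall_const,
    beq_iff_eq] at hf
  ext i j
  exact (r3 i j).symm.trans ((Bool.eq_iff_iff.1 (hf i j)).trans (r1 i j))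

/-- The adjacency matrix on four vertices where the neighbours of `0` are `1` and `2`. -/
def matrix4 (p q r : Bool) (i j : Fin 4) : Bool :=
  (![![false, true, true, false], ![true, false, p, q], ![true, p, false, r],
    ![false, q, r, false]] : Fin 4 → Fin 4 → Bool) i j

/-- The adjacency matrix on five vertices where the neighbours of `0` are `1` and `2`. -/
def matrix5 (p q r s t u : Bool) (i j : Fin 5) : Bool :=
  (![![false, true, true, false, false], ![true, false, p, q, r], ![true, p, false, s, t],
    ![false, q, s, false, u], ![false, r, t, u, false]] : Fin 5 → Fin 5 → Bool) i j

set_option maxRecDepth 100000 in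
theorem recursB_matrix4 : ∀ p q r, (List.finRange 4).any (fullB (matrix4 p q r)) = true ∨
    recursB (tabulate (matrix4 p q r)) = true := by
  decide +kernel

-- Period two cannot be improved to a fixed point: `step` sends the 5-cycle to its complement, again
-- a 5-cycle, and back.
set_option maxRecDepth 100000 in
theorem recursB_matrix5 : ∀ p q r s t u,
    (List.finRange 5).any (fullB (matrix5 p q r s t u)) = true ∨
    recursB (tabulate (matrix5 p q r s t u)) = true := by
  decide +kernel

open Classical in
theorem iterate_eq_of_fin_four (G : SimpleGraph (Fin 4)) (h0 : ∀ w, G.Adj 0 w ↔ w = 1 ∨ w = 2)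
    (hf : ∀ v, ¬ IsFull G v) (hG : ∀ i ≤ 3, IsSP (step^[i] G)) : step^[3] G = step^[1] G := by
  have h : Represents (matrix4 (decide (G.Adj 1 2)) (decide (G.Adj 1 3)) (decide (G.Adj 2 3))) G := by
    intro i j
    have h0' : ∀ w, G.Adj w 0 ↔ w = 1 ∨ w = 2 := fun w => (G.adj_comm w 0).trans (h0 w)
    fin_cases i <;> fin_cases j <;> simp [matrix4, h0, h0', G.adj_comm]
  refine h.tabulate.iterate_eq ((recursB_matrix4 _ _ _).resolve_left ?_) hG
  simp [h.fullB, hf]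

open Classical in
theorem iterate_eq_of_fin_five (G : SimpleGraph (Fin 5)) (h0 : ∀ w, G.Adj 0 w ↔ w = 1 ∨ w = 2)
    (hf : ∀ v, ¬ IsFull G v) (hG : ∀ i ≤ 3, IsSP (step^[i] G)) : step^[3] G = step^[1] G := by
  have h : Represents (matrix5 (decide (G.Adj 1 2)) (decide (G.Adj 1 3)) (decide (G.Adj 1 4))
      (decide (G.Adj 2 3)) (decide (G.Adj 2 4)) (decide (G.Adj 3 4))) G := by
    intro i j
    have h0' : ∀ w, G.Adj w 0 ↔ w = 1 ∨ w = 2 := fun w => (G.adj_comm w 0).trans (h0 w)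
    fin_cases i <;> fin_cases j <;> simp [matrix5, h0, h0', G.adj_comm]
  refine h.tabulate.iterate_eq ((recursB_matrix5 _ _ _ _ _ _).resolve_left ?_) hG
  simp [h.fullB, hf]

end

/-! ### Eventual periodicity of the iterates -/

theorem iterate_eq_of_comap {V W : Type*} (e : W ≃ V) {G : SimpleGraph V} {k l : ℕ}
    (h : step^[k] (G.comap e) = step^[l] (G.comap e)) : step^[k] G = step^[l] G := by
  have hG : G = (G.comap e).comap e.symm := by
    ext u v
    simp
  rw [hG, iterate_step_comap e.symm, iterate_step_comap e.symm, h]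

theorem roomy_of_card {V : Type*} [Fintype V] (h : 6 ≤ Fintype.card V) (a b c : V) :
    Roomy a b c := by
  classical
  intro u v
  by_contra! hc
  have : (Finset.univ : Finset V) ⊆ {a, b, c, u, v} := fun r _ => by
    have := hc r
    unfold Outside at this
    simp only [Finset.mem_insert, Finset.mem_singleton]
    tauto
  have := (Finset.card_le_card this).trans Finset.card_le_five
  rw [Finset.card_univ] at this
  omega

/-- If a vertex has exactly the two neighbours `y` and `z`, then the singleton coalition chain is
eventually periodic as soon as it has five arrows. -/
theorem iterate_step_eq {V : Type*} [Fintype V] {G : SimpleGraph V} {x y z : V}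
    (hyz : y ≠ z) (hN : ∀ w, G.Adj x w ↔ w = y ∨ w = z) (hf : ∀ v, ¬ IsFull G v)
    (hG : ∀ i ≤ 4, IsSP (step^[i] G)) : step^[3] G = step^[1] G := by
  classical
  have hxy : x ≠ y := ((hN y).2 (Or.inl rfl)).ne
  have hxz : x ≠ z := ((hN z).2 (Or.inr rfl)).ne
  rcases le_or_gt 6 (Fintype.card V) with hV | hV
  · have hcore := isCore_step_of_neighbors hxy hxz hyz fun w h => (hN w).1 h
    have h := hcore.step_eq_self (roomy_of_card hV x y z) fun i hi => hG (i + 1) (by omega)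
    change step (step (step G)) = step G
    rw [h, h]
  set R : Finset V := Finset.univ \ {x, y, z} with hR
  have hmemR : ∀ v, v ∈ R ↔ Outside x y z v := by simp [hR, Outside]
  have hcard : R.card + 3 = Fintype.card V := by
    have h3 : ({x, y, z} : Finset V).card = 3 := Finset.card_eq_three.2 ⟨x, y, z, hxy, hxz, hyz, rfl⟩
    rw [hR, ← h3, Finset.card_sdiff_add_card_eq_card (Finset.subset_univ _), Finset.card_univ]
  -- Listing `x`, `y`, `z` first relabels `G` so that `0` has neighbours `1` and `2`, as in the
  -- finite check.
  have small : ∀ l : List V, (x :: y :: z :: l).Nodup → (∀ v, Outside x y z v → v ∈ l) →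
      (l.length = 1 ∨ l.length = 2) → step^[3] G = step^[1] G := by
    intro l hl hmem hlen
    have hall : ∀ v, v ∈ x :: y :: z :: l := fun v => by
      have := hmem v
      unfold Outside at this
      simp only [List.mem_cons]
      tauto
    let e := hl.getEquivOfForallMemList _ hall
    have hadj : ∀ w, (G.comap e).Adj ⟨0, by simp⟩ w ↔ w = ⟨1, by simp⟩ ∨ w = ⟨2, by simp⟩ := by
      intro w
      rw [← e.apply_eq_iff_eq, ← e.apply_eq_iff_eq]
      exact hN (e w)
    have hf' : ∀ v, ¬ IsFull (G.comap e) v := fun v h => hf _ ((isFull_comap e G v).1 h)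
    have hG' : ∀ i ≤ 3, IsSP (step^[i] (G.comap e)) := fun i hi => by
      rw [iterate_step_comap, isSP_comap]
      exact hG i (by omega)
    refine iterate_eq_of_comap e ?_
    rcases hlen with hlen | hlen
    · obtain ⟨p, rfl⟩ := List.length_eq_one_iff.1 hlen
      exact iterate_eq_of_fin_four _ hadj hf' hG'
    · obtain ⟨p, q, rfl⟩ := List.length_eq_two.1 hlen
      exact iterate_eq_of_fin_five _ hadj hf' hG'
  -- With no outside vertex, `x` would be full.
  have hlow : R.card ≠ 0 := by
    intro h0
    refine hf x fun w hw => ((hN w).2 ?_).symm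
    by_contra! hc
    have := (hmemR w).2 ⟨hw, hc⟩
    rw [Finset.card_eq_zero.1 h0] at this
    simp at this
  refine small R.toList ?_ (fun v hv => by simpa using (hmemR v).2 hv) ?_
  · simp [hmemR, Outside, hxy, hxz, hyz, R.nodup_toList]
  · rw [Finset.length_toList]
    omega

theorem isSP_iterate {V : Type*} {G : SimpleGraph V} (h : step^[3] G = step^[1] G)
    (hG : ∀ i ≤ 2, IsSP (step^[i] G)) (i : ℕ) : IsSP (step^[i] G) := by
  induction i using Nat.strong_induction_on with
  | _ i ih =>
    rcases le_or_gt i 2 with hi | hi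
    · exact hG i hi
    · obtain ⟨k, rfl⟩ := Nat.exists_eq_add_of_lt hi
      have : step^[2 + k + 1] G = step^[k + 1] G := by
        rw [show 2 + k + 1 = k + 3 by ring, Function.iterate_add_apply, h,
          ← Function.iterate_add_apply]
      rw [this]
      exact ih _ (by omega)

/-! ### Chains -/

section
variable {V : Type u} {G : SimpleGraph V} {ℓ : ℕ∞} {S : ℕ → BundledGraph.{u}}

theorem IsSCChain.nonempty_iso (h : IsSCChain G ℓ S) (i : ℕ) (hi : (i : ℕ∞) ≤ ℓ) :
    Nonempty (step^[i] G ≃g (S i).graph) := by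
  induction i with
  | zero =>
    rw [h.1]
    exact ⟨SimpleGraph.Iso.refl⟩
  | succ i ih =>
    have hlt : (i : ℕ∞) < ℓ := lt_of_lt_of_le (by exact_mod_cast i.lt_succ_self) hi
    obtain ⟨φ⟩ := ih hlt.le
    obtain ⟨ψ⟩ := (h.2 i hlt).2
    rw [Function.iterate_succ_apply']
    exact ⟨((stepCongr φ).trans (stepIso _)).trans ψ⟩

theorem IsSCChain.isSP (h : IsSCChain G ℓ S) (i : ℕ) (hi : (i : ℕ∞) < ℓ) :
    IsSP (step^[i] G) :=
  let ⟨φ⟩ := h.nonempty_iso i hi.le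
  (isSPGraph_iff.1 (h.2 i hi).1).of_iso φ

theorem isSCChain_top (h : ∀ i, IsSP (step^[i] G)) :
    IsSCChain G ⊤ fun i => ⟨V, step^[i] G⟩ := by
  refine ⟨rfl, fun i _ => ⟨isSPGraph_iff.2 (h i), ?_⟩⟩
  change Nonempty (singletonCoalitionGraph (step^[i] G) ≃g step^[i + 1] G)
  rw [Function.iterate_succ_apply']
  exact ⟨(stepIso _).symm⟩

theorem chainLength_le (ℓ : ℕ∞) (S : ℕ → BundledGraph.{u}) : chainLength ℓ S ≤ ℓ := by
  unfold chainLength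
  split_ifs
  exacts [zero_le, le_rfl]

/-- If all iterates are singleton-partition graphs, then `LSCC G` is `⊤`, or it is `0` because all
iterates are isomorphic. -/
theorem LSCC_eq_top_or_zero (h : ∀ i, IsSP (step^[i] G)) : LSCC G = ⊤ ∨ LSCC G = 0 := by
  by_cases hiso : ∀ i j, Nonempty (step^[i] G ≃g step^[j] G)
  · right
    rw [← nonpos_iff_eq_zero]
    refine sSup_le ?_
    rintro _ ⟨ℓ, S, hS, rfl⟩
    rw [chainLength, if_pos]
    intro i j hi hj
    obtain ⟨φ⟩ := hS.nonempty_iso i hi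
    obtain ⟨ψ⟩ := hS.nonempty_iso j hj
    obtain ⟨θ⟩ := hiso i j
    exact ⟨(φ.symm.trans θ).trans ψ⟩
  · left
    rw [eq_top_iff]
    refine le_sSup ⟨⊤, _, isSCChain_top h, ?_⟩
    rw [chainLength, if_neg]
    exact fun h' => hiso fun i j => h' i j le_top le_top

/-- A bound on the number of consecutive iterates that are singleton-partition graphs, unless all of
them are, bounds `LSCC G`. -/
theorem LSCC_eq_top_or_le (k : ℕ) (h : (∀ i ≤ k, IsSP (step^[i] G)) → ∀ i, IsSP (step^[i] G)) :
    LSCC G = ⊤ ∨ LSCC G ≤ k := by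
  by_cases hall : ∀ i, IsSP (step^[i] G)
  · exact (LSCC_eq_top_or_zero hall).imp_right fun h0 => by simp [h0]
  · refine Or.inr (sSup_le ?_)
    rintro _ ⟨ℓ, S, hS, rfl⟩
    refine (chainLength_le ℓ S).trans ?_
    by_contra! hk
    -- With more than `k` arrows, each of the terms `0, …, k` is the source of one, hence SP.
    exact hall (h fun i hi => hS.isSP i (lt_of_le_of_lt (by exact_mod_cast hi) hk))

end

end Coalition

theorem mainTheorem4 {V : Type u} [Fintype V] (G : SimpleGraph V) [DecidableRel G.Adj]
    (hSP : Coalition.IsSPGraph G) (hδ : G.minDegree = 2) (hfull : ∀ v : V, ¬ G.IsUniversal v) :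
    Coalition.LSCC G = ⊤ ∨ Coalition.LSCC G ≤ 5 := by
  classical
  have hV : Nonempty V := by
    by_contra hV
    rw [not_nonempty_iff] at hV
    -- `minDegree` is `0` on an empty vertex type.
    simp at hδ
  obtain ⟨x, hx⟩ := G.exists_minimal_degree_vertex
  rw [hδ, ← SimpleGraph.card_neighborFinset_eq_degree] at hx
  obtain ⟨y, z, hyz, hN⟩ := Finset.card_eq_two.1 hx.symm
  -- There is slack here: only the iterates with `i ≤ 4` are used.
  refine Coalition.LSCC_eq_top_or_le 5 fun h => Coalition.isSP_iterate ?_ fun i hi => h i (by omega)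
  refine Coalition.iterate_step_eq (x := x) hyz (fun w => ?_)
    (fun v hv => hfull v fun w hw => (hv w hw.symm).symm) fun i hi => h i (by omega)
  rw [← SimpleGraph.mem_neighborFinset, hN, Finset.mem_insert, Finset.mem_singleton]
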